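/- Let $K$ be a field of characteristic zero, let $R=K[x_1,\dots,x_n]$, and let $R'=K[X_1,\dots,X_n]$, regarded as an $R$-module through the contraction action, i.e. the $K$-linear action in which $x^u\circ X^v=X^{v-u}$ if $u\le v$ componentwise and $x^u\circ X^v=0$ otherwise (so $X^v$ denotes a divided power monomial; products of monomials are written $X^a\cdot X^b=X^{a+b}$). For $F\in R'$ put $\operatorname{Ann}_R(F)=\{f\in R : f\circ F=0\}$ and $A_F=R/\operatorname{Ann}_R(F)$, and let $[A_F]_j$ be the image in $A_F$ of the forms of degree $j$ in $R$. **Theorem.** Let $g,m_1,m_2$ be monomials in $R'$ and suppose that $$F=g\,(m_1-m_2)\ \text{ is homogeneous},\qquad \gcd(m_1,m_2)=1,\qquad \deg g<\left\lfloor\frac{\deg F-1}{2}\right\rfloor .$$ Then $A_F$ has the weak Lefschetz property: there is a linear form $\ell\in[A_F]_1$ such that for every $i\ge 0$ the multiplication map $\times\ell\colon[A_F]_i\to[A_F]_{i+1}$ is injective or surjective. Moreover, the Hilbert function $j\mapsto\dim_K[A_F]_j$ of $A_F$ is unimodal, i.e. there is an index $k$ such that it is non-decreasing for $j\le k$ and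 non-increasing for $j\ge k$. -/

import Mathlib

open MvPolynomial

namespace BinomialGorenstein

/-! ### Standard graded algebras: Hilbert function and weak Lefschetz property -/

section Graded

variable {K A : Type*} [Field K] [CommRing A] [Algebra K A]

/-- The Hilbert function `j ↦ dim_K [A]_j` of an algebra with graded pieces `𝒜 j = [A]_j`. -/
noncomputable def hilbertFunction (𝒜 : ℕ → Submodule K A) (j : ℕ) : ℕ :=
  Module.finrank K (𝒜 j)

/-- A sequence is unimodal if it is weakly increasing up to some index
and weakly decreasing from that index on. -/
def IsUnimodal (h : ℕ → ℕ) : Prop :=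
  ∃ k, MonotoneOn h (Set.Iic k) ∧ AntitoneOn h (Set.Ici k)

/-- The multiplication map `×ℓ : [A]_i → [A]_{i+1}` by an element `ℓ` of degree one. -/
def mulByLinear (𝒜 : ℕ → Submodule K A) [SetLike.GradedMonoid 𝒜] (ℓ : 𝒜 1) (i : ℕ) :
    𝒜 i →ₗ[K] 𝒜 (i + 1) :=
  (LinearMap.mulRight K (ℓ : A)).restrict fun _ hx => SetLike.mul_mem_graded hx ℓ.2

/-- The weak Lefschetz property: for some `ℓ ∈ [A]_1`, every map `×ℓ : [A]_i → [A]_{i+1}` has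
maximal rank, that is, is injective or surjective. -/
def HasWeakLefschetzProperty (𝒜 : ℕ → Submodule K A) [SetLike.GradedMonoid 𝒜] : Prop :=
  ∃ ℓ : 𝒜 1, ∀ i : ℕ,
    Function.Injective (mulByLinear 𝒜 ℓ i) ∨ Function.Surjective (mulByLinear 𝒜 ℓ i)

end Graded

/-! ### Contraction and Macaulay duality -/

section Macaulay

variable {K : Type*} [Field K] {n : ℕ}

/-- The contraction action `f ∘ F` of `R = K[x_1, …, x_n]` on `R' = K[X_1, …, X_n]`.
The element `F` is written in the monomial basis `X^v` of `R'` (the divided power monomials);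
the monomial `x^u` sends `X^v` to `X^(v - u)` if `u ≤ v`, and to `0` otherwise
(this is what `F.divMonomial u` does), extended linearly. -/
noncomputable def contract (f F : MvPolynomial (Fin n) K) : MvPolynomial (Fin n) K :=
  ∑ u ∈ f.support, f.coeff u • F.divMonomial u

theorem contract_eq_of_subset (f F : MvPolynomial (Fin n) K) {s : Finset (Fin n →₀ ℕ)}
    (hs : f.support ⊆ s) : contract f F = ∑ u ∈ s, f.coeff u • F.divMonomial u := by
  refine Finset.sum_subset hs fun u _ hu => ?_
  rw [notMem_support_iff.1 hu, zero_smul]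

theorem contract_add_left (f g F : MvPolynomial (Fin n) K) :
    contract (f + g) F = contract f F + contract g F := by
  classical
  rw [contract_eq_of_subset f F (s := f.support ∪ g.support) Finset.subset_union_left,
    contract_eq_of_subset g F (s := f.support ∪ g.support) Finset.subset_union_right,
    contract_eq_of_subset (f + g) F (s := f.support ∪ g.support) support_add,
    ← Finset.sum_add_distrib]
  simp only [coeff_add, add_smul]

theorem contract_monomial_left (u : Fin n →₀ ℕ) (a : K) (F : MvPolynomial (Fin n) K) :
    contract (monomial u a) F = a • F.divMonomial u := by
  classical
  rw [contract_eq_of_subset _ F (s := {u}) support_monomial_subset]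
  simp

theorem zero_contract (F : MvPolynomial (Fin n) K) : contract 0 F = 0 := by
  simp [contract]

theorem coeff_contract (f F : MvPolynomial (Fin n) K) (v : Fin n →₀ ℕ) :
    (contract f F).coeff v = ∑ u ∈ f.support, f.coeff u * F.coeff (u + v) := by
  simp [contract, coeff_sum, coeff_divMonomial]

theorem contract_zero (f : MvPolynomial (Fin n) K) : contract f 0 = 0 := by
  ext v
  simp [coeff_contract]

theorem contract_add_right (f F G : MvPolynomial (Fin n) K) :
    contract f (F + G) = contract f F + contract f G := by
  ext v
  simp [coeff_contract, mul_add, Finset.sum_add_distrib]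

theorem one_contract (F : MvPolynomial (Fin n) K) : contract 1 F = F := by
  have h := contract_monomial_left (0 : Fin n →₀ ℕ) (1 : K) F
  rw [one_smul, divMonomial_zero] at h
  exact h

/-- Contraction is a module action. -/
theorem mul_contract (f g F : MvPolynomial (Fin n) K) :
    contract (f * g) F = contract f (contract g F) := by
  induction f using MvPolynomial.induction_on' with
  | add p q hp hq => rw [add_mul, contract_add_left, contract_add_left, hp, hq]
  | monomial u a =>
    induction g using MvPolynomial.induction_on' with
    | add p q hp hq =>
      rw [mul_add, contract_add_left, contract_add_left, contract_add_right, hp, hq]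
    | monomial v b =>
      rw [monomial_mul, contract_monomial_left, contract_monomial_left, contract_monomial_left]
      ext w
      simp only [coeff_smul, coeff_divMonomial, smul_eq_mul, mul_assoc]
      rw [add_comm u v, add_assoc]

/-- On the variables, contraction is given by the usual rule `x_i ∘ X^v = X^(v - e_i)`
if `X_i` divides `X^v`, and `x_i ∘ X^v = 0` otherwise. -/
theorem X_contract_monomial (i : Fin n) (v : Fin n →₀ ℕ) :
    contract (X i : MvPolynomial (Fin n) K) (monomial v 1) =
      if 0 < v i then monomial (v - Finsupp.single i 1) 1 else 0 := by
  classical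
  have h := contract_monomial_left (Finsupp.single i 1) (1 : K) (monomial v 1)
  rw [one_smul] at h
  refine h.trans ?_
  ext w
  rw [coeff_divMonomial, coeff_monomial]
  split_ifs with h1 h2 h2
  · rw [coeff_monomial, if_pos]
    rw [h1, add_tsub_cancel_left]
  · exact absurd (by rw [h1]; simp) h2
  · rw [coeff_monomial, if_neg]
    rintro rfl
    refine h1 (add_tsub_cancel_of_le ?_).symm
    exact Finsupp.single_le_iff.2 (Nat.succ_le_of_lt h2)
  · simp

/-- `Ann_R(F) = {f ∈ R | f ∘ F = 0}`. -/
noncomputable def annihilator (F : MvPolynomial (Fin n) K) : Ideal (MvPolynomial (Fin n) K) where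
  carrier := {f | contract f F = 0}
  add_mem' {f g} hf hg := by
    simp only [Set.mem_ofPred_eq] at hf hg ⊢
    rw [contract_add_left, hf, hg, add_zero]
  zero_mem' := zero_contract F
  smul_mem' c f hf := by
    simp only [Set.mem_ofPred_eq] at hf ⊢
    rw [smul_eq_mul, mul_contract, hf, contract_zero]

/-- The algebra `A_F = R / Ann_R(F)` with Macaulay dual generator `F`. -/
abbrev MacaulayAlgebra (F : MvPolynomial (Fin n) K) : Type _ :=
  MvPolynomial (Fin n) K ⧸ annihilator F

/-- The graded piece `[A_F]_j`: the image of the space of forms of degree `j`. -/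
noncomputable def gradedPiece (F : MvPolynomial (Fin n) K) (j : ℕ) :
    Submodule K (MacaulayAlgebra F) :=
  (homogeneousSubmodule (Fin n) K j).map (Ideal.Quotient.mkₐ K (annihilator F)).toLinearMap

instance (F : MvPolynomial (Fin n) K) : SetLike.GradedMonoid (gradedPiece F) where
  one_mem := ⟨1, isHomogeneous_one (Fin n) K, map_one (Ideal.Quotient.mkₐ K (annihilator F))⟩
  mul_mem := by
    rintro i j _ _ ⟨f, hf, rfl⟩ ⟨g, hg, rfl⟩
    exact ⟨f * g, IsHomogeneous.mul hf hg, map_mul (Ideal.Quotient.mkₐ K (annihilator F)) f g⟩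

/-- A monomial `X^a = X_1^{a_1} ⋯ X_n^{a_n}` of `R'`. Products of monomials are formed by adding
the exponents, `X^a · X^b = X^(a+b)`. -/
def IsMonomial (m : MvPolynomial (Fin n) K) : Prop :=
  ∃ a : Fin n →₀ ℕ, m = monomial a 1

end Macaulay

end BinomialGorenstein

/-! Take `ℓ` to be the sum of the variables and put `d = deg F`. By Macaulay duality `[A_F]_i` and
`[A_F]_{d-i}` are dual, so injectivity of `×ℓ` for `2i < d` gives surjectivity for `2i ≥ d`, and
unimodality follows (`weakLefschetz_and_unimodal`).

For injectivity, write `F = X^p - X^q`. Since `gcd(m₁, m₂) = 1`, a common divisor of `X^p` and `X^q`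
divides `g`. Hence for a form `f` with `deg g + deg f < d`, the contractions `f ∘ X^p` and `f ∘ X^q`
share no monomial, and `f` annihilates `F` iff it annihilates both terms
(`mem_annihilator_binomial_iff`). The bound on `deg g` puts `f` and `ℓf` in this range. What remains
is injectivity for the monomial complete intersections `A_{X^p}` and `A_{X^q}`, an `𝔰𝔩₂` argument in
characteristic zero (`mem_annihilator_monomial_of_sumX_mul`). -/

namespace BinomialGorenstein

/-! ### The Lefschetz element and a lowering operator -/

section Lowering

variable {K : Type*} [Field K] {n : ℕ}

/-- The sum of the variables. -/
noncomputable def sumX (K : Type*) [Field K] (n : ℕ) : MvPolynomial (Fin n) K :=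
  ∑ j, X j

theorem isHomogeneous_sumX : (sumX K n).IsHomogeneous 1 :=
  IsHomogeneous.sum _ _ _ fun j _ => isHomogeneous_X K j

/-- The differential operator `∑ j, (a_j ∂_j - x_j ∂_j ^ 2)`, which together with multiplication by
the sum of the variables generates an action of `𝔰𝔩₂` on `K[x] / (x_j ^ (a_j + 1))`. -/
noncomputable def lowering (a : Fin n →₀ ℕ) : MvPolynomial (Fin n) K →ₗ[K] MvPolynomial (Fin n) K :=
  ∑ j, ((a j : K) • (pderiv j).toLinearMap -
    (LinearMap.mulLeft K (X j)) ∘ₗ (pderiv j).toLinearMap ∘ₗ (pderiv j).toLinearMap)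

theorem lowering_apply (a : Fin n →₀ ℕ) (f : MvPolynomial (Fin n) K) :
    lowering a f = ∑ j, ((a j : K) • pderiv j f - X j * pderiv j (pderiv j f)) := by
  simp [lowering]

theorem lowering_isHomogeneous (a : Fin n →₀ ℕ) {f : MvPolynomial (Fin n) K} {i : ℕ}
    (hf : f.IsHomogeneous (i + 1)) : (lowering a f).IsHomogeneous i := by
  rw [lowering_apply]
  refine IsHomogeneous.sum _ _ _ fun j _ => ?_
  have h1 : (pderiv j f).IsHomogeneous i := hf.pderiv
  refine IsHomogeneous.sub ((homogeneousSubmodule (Fin n) K i).smul_mem _ h1) ?_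
  -- For `i = 0` the degree `i - 1` of the second derivative is truncated; there the first
  -- derivative is constant and the second is zero.
  cases i with
  | zero =>
    have h2 : (pderiv j f).totalDegree = 0 := (totalDegree_zero_iff_isHomogeneous _).2 h1
    rw [totalDegree_eq_zero_iff_eq_C.1 h2, pderiv_C, mul_zero]
    exact isHomogeneous_zero _ _ _
  | succ i =>
    have := (isHomogeneous_X K j).mul (h1.pderiv (i := j))
    rwa [Nat.add_sub_cancel, add_comm] at this

theorem lowering_eq_zero (a : Fin n →₀ ℕ) {f : MvPolynomial (Fin n) K}
    (hf : f.IsHomogeneous 0) : lowering a f = 0 := by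
  rw [totalDegree_eq_zero_iff_eq_C.1 ((totalDegree_zero_iff_isHomogeneous _).2 hf), lowering_apply]
  simp

theorem pderiv_sumX_mul (j : Fin n) (f : MvPolynomial (Fin n) K) :
    pderiv j (sumX K n * f) = f + sumX K n * pderiv j f := by
  classical
  have h : pderiv j (sumX K n) = 1 := by
    simp [sumX, pderiv_X, Pi.single_apply]
  rw [pderiv_mul, h, one_mul]

/-- The `𝔰𝔩₂` commutator relation: the weight of degree `i` is `|a| - 2i`, by Euler's identity `∑
x_j ∂_j f = i f`. -/
theorem lowering_sumX_mul (a : Fin n →₀ ℕ) {f : MvPolynomial (Fin n) K} {i : ℕ}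
    (hf : f.IsHomogeneous i) :
    lowering a (sumX K n * f) =
      sumX K n * lowering a f + ((a.degree : K) - 2 * i) • f := by
  have hE := hf.sum_X_mul_pderiv
  have ha : (a.degree : K) = ∑ j, (a j : K) := by
    rw [Finsupp.degree_eq_sum]; push_cast; rfl
  have h : ∀ j : Fin n, (a j : K) • pderiv j (sumX K n * f) -
      X j * pderiv j (pderiv j (sumX K n * f)) =
      sumX K n * ((a j : K) • pderiv j f - X j * pderiv j (pderiv j f)) +
        ((a j : K) • f - 2 * (X j * pderiv j f)) := by
    intro j
    rw [pderiv_sumX_mul, map_add, pderiv_sumX_mul]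
    simp only [smul_eq_C_mul]
    ring
  rw [lowering_apply, lowering_apply, Finset.sum_congr rfl fun j _ => h j,
    Finset.sum_add_distrib, ← Finset.mul_sum,
    Finset.sum_sub_distrib (fun j => (a j : K) • f), ← Finset.mul_sum, hE, ← Finset.sum_smul,
    ← ha, sub_smul]
  simp only [smul_eq_C_mul, nsmul_eq_mul, map_mul, map_natCast, map_ofNat]
  ring

end Lowering

/-! ### Monomial complete intersections -/

section Monomial

variable {K : Type*} [Field K] {n : ℕ}

theorem coeff_contract_monomial (f : MvPolynomial (Fin n) K) (a v : Fin n →₀ ℕ) :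
    (contract f (monomial a 1)).coeff v = if v ≤ a then f.coeff (a - v) else 0 := by
  classical
  rw [coeff_contract]
  simp only [coeff_monomial, mul_ite, mul_one, mul_zero]
  split_ifs with h
  · have hu : ∀ u, a = u + v ↔ a - v = u := fun u =>
      ⟨fun e => by rw [e, add_tsub_cancel_right], fun e => by rw [← e, tsub_add_cancel_of_le h]⟩
    simp only [hu, Finset.sum_ite_eq]
    split_ifs with h'
    · rfl
    · exact (notMem_support_iff.1 h').symm
  · exact Finset.sum_eq_zero fun u _ => if_neg fun e => h (by rw [e]; exact le_add_self)

theorem mem_annihilator {f F : MvPolynomial (Fin n) K} :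
    f ∈ annihilator F ↔ contract f F = 0 := Iff.rfl

theorem mem_annihilator_monomial {f : MvPolynomial (Fin n) K} {a : Fin n →₀ ℕ} :
    f ∈ annihilator (monomial a (1 : K)) ↔ ∀ u ≤ a, f.coeff u = 0 := by
  rw [mem_annihilator]
  constructor
  · intro h u hu
    have := congrArg (coeff (a - u)) h
    rwa [coeff_contract_monomial, if_pos tsub_le_self, tsub_tsub_cancel_of_le hu,
      coeff_zero] at this
  · intro h
    ext v
    rw [coeff_contract_monomial, coeff_zero]
    split_ifs
    · exact h _ tsub_le_self
    · rfl

/-- The operator descends to the quotient `A_{X^a}`: the only terms that could bring an exponent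
`a_j + 1` down to `a_j` carry the factor `a_j - u_j = 0`. -/
theorem lowering_mem_annihilator_monomial {f : MvPolynomial (Fin n) K} {a : Fin n →₀ ℕ}
    (hf : f ∈ annihilator (monomial a (1 : K))) :
    lowering a f ∈ annihilator (monomial a (1 : K)) := by
  classical
  rw [mem_annihilator_monomial] at hf ⊢
  intro u hu
  rw [lowering_apply, coeff_sum]
  refine Finset.sum_eq_zero fun j _ => ?_
  have key : coeff u ((a j : K) • pderiv j f - X j * pderiv j (pderiv j f)) =
      ((a j : K) - u j) * ((u j + 1) * f.coeff (u + Finsupp.single j 1)) := by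
    rw [coeff_sub, coeff_smul, coeff_pderiv, coeff_X_mul']
    split_ifs with h
    · have h1 : u - Finsupp.single j 1 + Finsupp.single j 1 = u :=
        tsub_add_cancel_of_le (Finsupp.single_le_iff.2
          (Nat.one_le_iff_ne_zero.2 (Finsupp.mem_support_iff.1 h)))
      have h2 : (((u - Finsupp.single j 1 : Fin n →₀ ℕ) j : ℕ) : K) + 1 = u j := by
        rw [← Nat.cast_add_one]
        refine congrArg Nat.cast ?_
        simpa only [Finsupp.add_apply, Finsupp.single_eq_same] using DFunLike.congr_fun h1 j
      rw [coeff_pderiv, h1, coeff_pderiv, h2, smul_eq_mul]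
      ring
    · rw [Finsupp.notMem_support_iff.1 h, smul_eq_mul]
      simp
  rw [key]
  rcases (hu j).lt_or_eq with hlt | heq
  · rw [hf, mul_zero, mul_zero]
    intro k
    rcases eq_or_ne k j with rfl | hk
    · simpa using hlt
    · simpa [Finsupp.single_eq_of_ne hk] using hu k
  · rw [heq, sub_self, zero_mul]

variable [CharZero K]

/-- The shift `c ≥ 0` makes the induction on degree close up: with `D` the lowering operator and `N
= |a|`, commuting `D` past `ℓ` and applying `D` again gives the same hypothesis for `Df`, with `c`
replaced by `N - 2i + c`. -/
theorem mem_annihilator_monomial_of_lowering_add {a : Fin n →₀ ℕ} :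
    ∀ {i : ℕ} {f : MvPolynomial (Fin n) K} (c : ℕ), f.IsHomogeneous i → 2 * i < a.degree →
      lowering a (sumX K n * f) + (c : K) • f ∈ annihilator (monomial a (1 : K)) →
      f ∈ annihilator (monomial a (1 : K)) := by
  intro i
  induction i with
  | zero =>
    intro f c hf hi h
    rw [lowering_sumX_mul a hf, lowering_eq_zero a hf, mul_zero, zero_add, ← add_smul] at h
    have hc : ((a.degree : K) - 2 * (0 : ℕ) + c) ≠ 0 := by
      have : a.degree + c ≠ 0 := by omega
      simpa using (by exact_mod_cast this : (a.degree : K) + c ≠ 0)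
    exact (Submodule.smul_mem_iff ((annihilator (monomial a (1 : K))).restrictScalars K) hc).1 h
  | succ i ih =>
    intro f c hf hi h
    obtain ⟨e, he⟩ := Nat.exists_eq_add_of_lt hi
    have hs : (a.degree : K) - 2 * (i + 1 : ℕ) + c = ((e + 1 + c : ℕ) : K) := by
      rw [he]; push_cast; ring
    rw [lowering_sumX_mul a hf, add_assoc, ← add_smul, hs] at h
    have h' := lowering_mem_annihilator_monomial h
    rw [map_add, map_smul] at h'
    have hD := ih (e + 1 + c) (lowering_isHomogeneous a hf) (by omega) h'
    -- As `Df` lies in the annihilator, only the positive multiple `(e + 1 + c) f` of `f` is left.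
    have hf' := (Submodule.add_mem_iff_right _ (Ideal.mul_mem_left _ (sumX K n) hD)).1 h
    refine (Submodule.smul_mem_iff ((annihilator (monomial a (1 : K))).restrictScalars K)
      ?_).1 hf'
    exact_mod_cast (by omega : e + 1 + c ≠ 0)

/-- In a monomial complete intersection of socle degree `N`, multiplication by the sum of the
variables is injective in degrees `i < N / 2`. -/
theorem mem_annihilator_monomial_of_sumX_mul {a : Fin n →₀ ℕ} {i : ℕ}
    {f : MvPolynomial (Fin n) K} (hf : f.IsHomogeneous i) (hi : 2 * i < a.degree)
    (h : sumX K n * f ∈ annihilator (monomial a (1 : K))) :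
    f ∈ annihilator (monomial a (1 : K)) := by
  refine mem_annihilator_monomial_of_lowering_add 0 hf hi ?_
  simpa using lowering_mem_annihilator_monomial h

end Monomial

/-! ### Macaulay duality -/

section Duality

variable {K : Type*} [Field K] {n : ℕ}

theorem coeff_contract_eq_zero {f F : MvPolynomial (Fin n) K} {d i : ℕ} (hF : F.IsHomogeneous d)
    (hf : f.IsHomogeneous i) {v : Fin n →₀ ℕ} (hv : i + v.degree ≠ d) :
    (contract f F).coeff v = 0 := by
  rw [coeff_contract]
  refine Finset.sum_eq_zero fun u hu => ?_
  have hu' : u.degree = i := by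
    by_contra hne
    exact mem_support_iff.1 hu (hf.coeff_eq_zero hne)
  rw [hF.coeff_eq_zero (d := u + v) (by rwa [map_add, hu']), mul_zero]

theorem contract_eq_zero_of_lt {f F : MvPolynomial (Fin n) K} {d i : ℕ} (hF : F.IsHomogeneous d)
    (hf : f.IsHomogeneous i) (hi : d < i) : contract f F = 0 := by
  ext v
  rw [coeff_contract_eq_zero hF hf (by omega), coeff_zero]

/-- The linear form `f ↦ (f ∘ F)(0)` on `A_F`. -/
noncomputable def evalZero (F : MvPolynomial (Fin n) K) : MacaulayAlgebra F →ₗ[K] K :=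
  (((annihilator F).restrictScalars K).liftQ
    { toFun := fun f => (contract f F).coeff 0
      map_add' := fun f g => by rw [contract_add_left, coeff_add]
      map_smul' := fun c f => by
        rw [smul_eq_C_mul, mul_contract, ← monomial_zero', contract_monomial_left]
        simp } fun f hf => by
        have h : contract f F = 0 := hf
        simp [h]) ∘ₗ (Submodule.Quotient.restrictScalarsEquiv K (annihilator F)).symm.toLinearMap

theorem evalZero_mk (F f : MvPolynomial (Fin n) K) :
    evalZero F (Ideal.Quotient.mkₐ K (annihilator F) f) = (contract f F).coeff 0 := rfl

/-- The pairing `[A_F]_i × [A_F]_j → K`, `(f, g) ↦ (fg ∘ F)(0)`. -/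
noncomputable def pairing (F : MvPolynomial (Fin n) K) (i j : ℕ) :
    gradedPiece F i →ₗ[K] gradedPiece F j →ₗ[K] K :=
  ((LinearMap.mul K (MacaulayAlgebra F)).compr₂ (evalZero F)).domRestrict₁₂
    (gradedPiece F i) (gradedPiece F j)

theorem pairing_apply (F : MvPolynomial (Fin n) K) {i j : ℕ} (x : gradedPiece F i)
    (y : gradedPiece F j) :
    pairing F i j x y = evalZero F ((x : MacaulayAlgebra F) * y) := rfl

instance (F : MvPolynomial (Fin n) K) (i : ℕ) : FiniteDimensional K (gradedPiece F i) :=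
  Module.Finite.iff_fg.2 ((homogeneousSubmodule_fg (σ := Fin n) (R := K) i).map _)

/-- Pairing `f` with `x^v` reads off the coefficient of `X^v` in `f ∘ F`, which is a form of degree
`j`. -/
theorem pairing_injective {F : MvPolynomial (Fin n) K} {d i j : ℕ} (hF : F.IsHomogeneous d)
    (hij : i + j = d) : Function.Injective (pairing F i j) := by
  rw [injective_iff_map_eq_zero]
  rintro ⟨_, f, hf, rfl⟩ h
  refine Subtype.ext (Ideal.Quotient.eq_zero_iff_mem.2 ?_)
  rw [mem_annihilator]
  ext v
  rw [coeff_zero]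
  by_cases hv : v.degree = j
  · have hmem : Ideal.Quotient.mkₐ K (annihilator F) (monomial v 1) ∈ gradedPiece F j :=
      ⟨_, isHomogeneous_monomial 1 hv, rfl⟩
    have h1 : evalZero F (Ideal.Quotient.mkₐ K (annihilator F) (f * monomial v 1)) = 0 := by
      rw [map_mul]
      exact LinearMap.congr_fun h ⟨_, hmem⟩
    rw [evalZero_mk, mul_comm, mul_contract, contract_monomial_left, one_smul,
      coeff_divMonomial, add_zero] at h1
    exact h1
  · exact coeff_contract_eq_zero hF hf (by omega)

theorem pairing_flip (F : MvPolynomial (Fin n) K) (i j : ℕ) :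
    (pairing F i j).flip = pairing F j i := by
  ext x y
  rw [LinearMap.flip_apply, pairing_apply, pairing_apply, mul_comm]

theorem pairing_isPerfPair {F : MvPolynomial (Fin n) K} {d i j : ℕ} (hF : F.IsHomogeneous d)
    (hij : i + j = d) : (pairing F i j).IsPerfPair :=
  .of_injective (pairing_injective hF hij)
    (by rw [pairing_flip]; exact pairing_injective hF (by omega))

/-- Multiplication by `ℓ` is surjective in degree `i` if it is injective in the dual degree. -/
theorem mulByLinear_surjective {F : MvPolynomial (Fin n) K} {d i j : ℕ} (hF : F.IsHomogeneous d)
    (ℓ : gradedPiece F 1) (hij : i + 1 + j = d)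
    (h : Function.Injective (mulByLinear (gradedPiece F) ℓ j)) :
    Function.Surjective (mulByLinear (gradedPiece F) ℓ i) := by
  rw [← LinearMap.dualMap_injective_iff, injective_iff_map_eq_zero]
  intro ψ hψ
  have hp := pairing_isPerfPair hF hij
  obtain ⟨y, rfl⟩ := hp.bijective_right.2 ψ
  -- The functional `ψ` is pairing with `y`; it kills the image of `×ℓ`, so `ℓy` is orthogonal to
  -- all of `[A_F]_i`.
  have hy : mulByLinear (gradedPiece F) ℓ j y = 0 := by
    refine pairing_injective (i := j + 1) (j := i) hF (by omega) ?_
    ext x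
    rw [map_zero, LinearMap.zero_apply]
    have hx : evalZero F ((x : MacaulayAlgebra F) * ℓ * y) = 0 := LinearMap.congr_fun hψ x
    rw [pairing_apply, ← hx]
    congr 1
    change (y : MacaulayAlgebra F) * ℓ * x = _
    ring
  rw [h (hy.trans (map_zero _).symm), map_zero]

theorem mulByLinear_surjective_of_le {F : MvPolynomial (Fin n) K} {d i : ℕ}
    (hF : F.IsHomogeneous d) (ℓ : gradedPiece F 1) (hi : d ≤ i) :
    Function.Surjective (mulByLinear (gradedPiece F) ℓ i) := by
  rintro ⟨_, f, hf, rfl⟩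
  refine ⟨0, Subtype.ext ?_⟩
  rw [map_zero]
  exact (Ideal.Quotient.eq_zero_iff_mem.2 (contract_eq_zero_of_lt hF hf (by omega))).symm

theorem mulByLinear_injective_of_forall {i : ℕ} {F l : MvPolynomial (Fin n) K} (hl : l.IsHomogeneous 1)
    (h : ∀ f : MvPolynomial (Fin n) K, f.IsHomogeneous i → l * f ∈ annihilator F →
      f ∈ annihilator F) :
    Function.Injective (mulByLinear (gradedPiece F)
      ⟨Ideal.Quotient.mkₐ K (annihilator F) l, l, hl, rfl⟩ i) := by
  rw [injective_iff_map_eq_zero]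
  rintro ⟨_, f, hf, rfl⟩ h0
  refine Subtype.ext (Ideal.Quotient.eq_zero_iff_mem.2 (h f hf ?_))
  refine Ideal.Quotient.eq_zero_iff_mem.1 ?_
  rw [mul_comm, map_mul]
  exact congrArg Subtype.val h0

/-- For a form `F` of degree `d`, injectivity of `×ℓ` in all degrees `i < d / 2` implies the weak
Lefschetz property and unimodality of the Hilbert function. -/
theorem weakLefschetz_and_unimodal {F : MvPolynomial (Fin n) K} {d : ℕ} (hF : F.IsHomogeneous d)
    (ℓ : gradedPiece F 1)
    (h : ∀ i, 2 * i < d → Function.Injective (mulByLinear (gradedPiece F) ℓ i)) :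
    HasWeakLefschetzProperty (gradedPiece F) ∧ IsUnimodal (hilbertFunction (gradedPiece F)) := by
  have hsurj : ∀ i, d ≤ 2 * i → Function.Surjective (mulByLinear (gradedPiece F) ℓ i) := by
    intro i hi
    rcases le_or_gt d i with hdi | hdi
    · exact mulByLinear_surjective_of_le hF ℓ hdi
    · exact mulByLinear_surjective hF ℓ (j := d - i - 1) (by omega) (h _ (by omega))
  -- The peak `⌈d/2⌉` is the first index `i` with `d ≤ 2i`.
  refine ⟨⟨ℓ, fun i => (lt_or_ge (2 * i) d).imp (h i) (hsurj i)⟩, (d + 1) / 2, ?_, ?_⟩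
  · refine monotoneOn_of_le_add_one Set.ordConnected_Iic fun i _ _ hi => ?_
    have hi' : i + 1 ≤ (d + 1) / 2 := hi
    exact LinearMap.finrank_le_finrank_of_injective (h i (by omega))
  · refine antitoneOn_of_add_one_le Set.ordConnected_Ici fun i _ hi _ => ?_
    have hi' : (d + 1) / 2 ≤ i := hi
    exact LinearMap.finrank_le_finrank_of_surjective (hsurj i (by omega))

end Duality

/-! ### Binomial dual generators -/

section Binomial

variable {K : Type*} [Field K] {n : ℕ}

theorem eq_zero_or_eq_zero_of_isRelPrime_monomial {a b : Fin n →₀ ℕ}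
    (h : IsRelPrime (monomial a (1 : K)) (monomial b 1)) (j : Fin n) : a j = 0 ∨ b j = 0 := by
  by_contra! hne
  have hX : IsUnit (X j : MvPolynomial (Fin n) K) :=
    h (X_dvd_monomial.2 (Or.inr hne.1)) (X_dvd_monomial.2 (Or.inr hne.2))
  exact X_prime.not_isUnit hX

theorem le_of_le_add_of_le_add {a b c v : Fin n →₀ ℕ} (h : ∀ j, a j = 0 ∨ b j = 0)
    (ha : v ≤ c + a) (hb : v ≤ c + b) : v ≤ c := by
  intro j
  have h1 := ha j
  have h2 := hb j
  simp only [Finsupp.add_apply] at h1 h2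
  rcases h j with h0 | h0 <;> omega

theorem contract_monomial_sub_monomial (f : MvPolynomial (Fin n) K) (p q : Fin n →₀ ℕ) :
    contract f (monomial p 1 - monomial q 1) =
      contract f (monomial p 1) - contract f (monomial q 1) := by
  rw [eq_sub_iff_add_eq, ← contract_add_right, sub_add_cancel]

/-- In degrees `k` for which no monomial of degree `d - k` divides both terms of a binomial `F`,
a form annihilates `F` if and only if it annihilates both terms. -/
theorem mem_annihilator_binomial_iff {p q : Fin n →₀ ℕ} {d e k : ℕ} (hp : p.degree = d)
    (hq : q.degree = d) (hpq : ∀ v, v ≤ p → v ≤ q → v.degree ≤ e) (hk : e + k < d)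
    {f : MvPolynomial (Fin n) K} (hf : f.IsHomogeneous k) :
    f ∈ annihilator (monomial p (1 : K) - monomial q 1) ↔
      f ∈ annihilator (monomial p (1 : K)) ∧ f ∈ annihilator (monomial q (1 : K)) := by
  simp only [mem_annihilator, contract_monomial_sub_monomial]
  refine ⟨fun h => ?_, fun h => by rw [h.1, h.2, sub_zero]⟩
  have heq := sub_eq_zero.1 h
  have h0 : contract f (monomial p (1 : K)) = 0 := by
    ext v
    rw [coeff_zero]
    by_cases hv : k + v.degree = d
    · by_cases hvp : v ≤ p
      · by_cases hvq : v ≤ q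
        · have := hpq v hvp hvq
          omega
        · rw [heq, coeff_contract_monomial, if_neg hvq]
      · rw [coeff_contract_monomial, if_neg hvp]
    · exact coeff_contract_eq_zero (isHomogeneous_monomial 1 hp) hf hv
  exact ⟨h0, heq ▸ h0⟩

theorem degree_eq_of_isHomogeneous_sub {p q : Fin n →₀ ℕ} {d : ℕ} (hpq : p ≠ q)
    (h : (monomial p (1 : K) - monomial q 1).IsHomogeneous d) : p.degree = d ∧ q.degree = d := by
  classical
  constructor
  · by_contra hne
    have := h.coeff_eq_zero hne
    simp [coeff_monomial, hpq.symm] at this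
  · by_contra hne
    have := h.coeff_eq_zero hne
    simp [coeff_monomial, hpq] at this

end Binomial

end BinomialGorenstein

open BinomialGorenstein in
theorem mainTheorem3 {K : Type*} [Field K] [CharZero K] {n d : ℕ}
    (g m₁ m₂ F : MvPolynomial (Fin n) K)
    (hg : BinomialGorenstein.IsMonomial g)
    (hm₁ : BinomialGorenstein.IsMonomial m₁)
    (hm₂ : BinomialGorenstein.IsMonomial m₂)
    (hF : F = g * (m₁ - m₂))
    (hd : F.IsHomogeneous d)
    (hgcd : IsRelPrime m₁ m₂)
    (hdeg : g.totalDegree < (F.totalDegree - 1) / 2) :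
    BinomialGorenstein.HasWeakLefschetzProperty (BinomialGorenstein.gradedPiece F) ∧
      BinomialGorenstein.IsUnimodal
        (BinomialGorenstein.hilbertFunction (BinomialGorenstein.gradedPiece F)) := by
  obtain ⟨c, rfl⟩ := hg
  obtain ⟨a, rfl⟩ := hm₁
  obtain ⟨b, rfl⟩ := hm₂
  rw [mul_sub, monomial_mul, monomial_mul, one_mul] at hF
  -- For `F = 0` the truncated bound `(0 - 1) / 2` is `0`, so `hdeg` fails.
  have hF0 : F ≠ 0 := by
    rintro rfl
    simp at hdeg
  have hne : c + a ≠ c + b := fun h => hF0 (by rw [hF, h, sub_self])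
  rw [hd.totalDegree hF0,
    (isHomogeneous_monomial (1 : K) (rfl : c.degree = c.degree)).totalDegree (by simp)] at hdeg
  subst hF
  obtain ⟨hp, hq⟩ := degree_eq_of_isHomogeneous_sub hne hd
  have hdvd : ∀ v, v ≤ c + a → v ≤ c + b → v.degree ≤ c.degree := fun v h1 h2 =>
    Finsupp.degree_mono
      (le_of_le_add_of_le_add (eq_zero_or_eq_zero_of_isRelPrime_monomial hgcd) h1 h2)
  refine weakLefschetz_and_unimodal hd _ fun i hi =>
    mulByLinear_injective_of_forall isHomogeneous_sumX fun f hf h => ?_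
  have hlf : (sumX K n * f).IsHomogeneous (i + 1) := add_comm 1 i ▸ isHomogeneous_sumX.mul hf
  -- From `2i < d` and `hdeg`, `deg g + i + 1 ≤ 2⌊(d - 1)/2⌋ < d`.
  rw [mem_annihilator_binomial_iff hp hq hdvd (by omega) hlf] at h
  rw [mem_annihilator_binomial_iff hp hq hdvd (by omega) hf]
  exact ⟨mem_annihilator_monomial_of_sumX_mul hf (by omega) h.1,
    mem_annihilator_monomial_of_sumX_mul hf (by omega) h.2⟩
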